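/- Let $J=\begin{pmatrix}0&I_m\\-I_m&0\end{pmatrix}$, let $H$ be a smooth ($C^\infty$) real-valued function on an open set $U\subseteq\mathbb{R}^{2m}$, and let $y:[t_0,t_0+T]\to U$ ($T>0$) be the solution of the Hamiltonian system $y'=J\nabla H(y)$, $y(t_0)=y_0$. For stepsizes $h>0$ let $y_1=y_1(h)\in\mathbb{R}^{2m}$ be given approximations with $y(t_0+h)=y_1+O(h^{p+1})$ as $h\to0^+$, for some integer $p\ge4$. For $z\in\mathbb{R}^{2m}$ put $$\gamma_z(\tau)=y_0+(z-y_0)\tau+2(z-2y_1+y_0)\tau(\tau-1),\qquad a(z)=\int_0^1\nabla H(\gamma_z(\tau))\,d\tau .$$ Then there exist constants $\rho>0$ and $h_0>0$ with $2h_0\le T$ such that, for every $0<h\le h_0$, the curves $\gamma_z([0,1])$ with $z\in B(y_0,\rho)$ lie in $U$, and the nonlinear system $$z=y_0+2hJ\,a(z)$$ has a unique solution $\hat z=\hat z(h)$ in the open ball $B(y_0,\rho)$ (Euclidean norm). Moreover this solution satisfies $$y(t_0+2h)-\hat z=O(h^5)\qquad\text{as } h\to0^+ .$$ -/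

import Mathlib

open Set Filter Topology Asymptotics
open scoped ContDiff Gradient

noncomputable section

/-- The phase space `ℝ^{2m}`, with the Euclidean norm; a point is `(q, p)` with `q, p ∈ ℝ^m`. -/
abbrev PhaseSpace (m : ℕ) : Type := EuclideanSpace ℝ (Fin m ⊕ Fin m)

/-- The canonical symplectic matrix `J = [[0, I], [-I, 0]]`. -/
def symplecticMatrix (m : ℕ) : Matrix (Fin m ⊕ Fin m) (Fin m ⊕ Fin m) ℝ :=
  Matrix.fromBlocks 0 1 (-1) 0

/-- The linear map `v ↦ J v` on the phase space. -/
def symplecticMap (m : ℕ) : PhaseSpace m →L[ℝ] PhaseSpace m :=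
  Matrix.toEuclideanCLM (𝕜 := ℝ) (symplecticMatrix m)

/-- `y` solves `y' = J ∇H(y)`, `y(t₀) = y₀`, on the interval `[t₀, t₀ + T]`, staying in the domain
`U` of `H` (the derivative is one-sided at the endpoints). -/
def IsHamiltonianSolution {m : ℕ} (U : Set (PhaseSpace m)) (H : PhaseSpace m → ℝ)
    (t₀ T : ℝ) (y₀ : PhaseSpace m) (y : ℝ → PhaseSpace m) : Prop :=
  y t₀ = y₀ ∧ ∀ t ∈ Icc t₀ (t₀ + T),
    y t ∈ U ∧ HasDerivWithinAt y (symplecticMap m (∇ H (y t))) (Icc t₀ (t₀ + T)) t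

/-- The quadratic curve `γ_z(τ) = y₀ + (z - y₀) τ + 2 (z - 2 y₁ + y₀) τ (τ - 1)`, which takes the
values `y₀, y₁, z` at `τ = 0, 1/2, 1`. -/
def quadCurve {m : ℕ} (y₀ y₁ z : PhaseSpace m) (τ : ℝ) : PhaseSpace m :=
  y₀ + τ • (z - y₀) + (2 * (τ * (τ - 1))) • (z - (2 : ℝ) • y₁ + y₀)

/-- The averaged gradient `a(z) = ∫₀¹ ∇H(γ_z(τ)) dτ`. -/
def averagedGradient {m : ℕ} (H : PhaseSpace m → ℝ) (y₀ y₁ z : PhaseSpace m) : PhaseSpace m :=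
  ∫ τ in (0 : ℝ)..1, ∇ H (quadCurve y₀ y₁ z τ)

/-- The map `Φ(z) = y₀ + 2 h J a(z)`. -/
def uncorrectedMap {m : ℕ} (H : PhaseSpace m → ℝ) (h : ℝ) (y₀ y₁ z : PhaseSpace m) :
    PhaseSpace m :=
  y₀ + (2 * h) • symplecticMap m (averagedGradient H y₀ y₁ z)

end

/-! The factor `2h` makes `Φ(z) = y₀ + 2hJ a(z)` a contraction with constant `1/2` for small `h`, so
the distance from `y(t₀ + 2h)` to the fixed point is at most twice its defect in the equation
(`norm_uncorrectedMap_sub_le`). By the integrated flow, that defect is `2hJ` times the difference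
between the averages of `∇H` along the exact curve and along its quadratic interpolant. The curves
differ by `-8h³ τ(τ - 1/2)(τ - 1) d + O(h⁴)` (`norm_quadCurve_sub_add_le`). Replacing `∇H` by its
linearization at `y₀` costs `O(h) · O(h³)`, and the cubic term integrates to zero because it is odd
about `1/2`. The averages thus agree to `O(h⁴)`, and the prefactor `2h` gives `O(h⁵)`. -/

theorem ContDiffOn.gradient_of_isOpen {E : Type*} [NormedAddCommGroup E] [InnerProductSpace ℝ E]
    [CompleteSpace E] {f : E → ℝ} {s : Set E} {m n : WithTop ℕ∞}
    (hf : ContDiffOn ℝ n f s) (hs : IsOpen s) (hmn : m + 1 ≤ n) :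
    ContDiffOn ℝ m (∇ f) s :=
  (InnerProductSpace.toDual ℝ E).symm.contDiff.comp_contDiffOn (hf.fderiv_of_isOpen hs hmn)

/-- A `C²` map is, near a point, Lipschitz and approximated by its derivative at that point with an
error that is controlled by the distance to the point. -/
theorem ContDiffOn.exists_ball_lipschitzOnWith_and_linearization
    {E F : Type*} [NormedAddCommGroup E] [NormedSpace ℝ E]
    [NormedAddCommGroup F] [NormedSpace ℝ F] {g : E → F} {U : Set E} {x₀ : E}
    (hg : ContDiffOn ℝ 2 g U) (hU : IsOpen U) (hx₀ : x₀ ∈ U) :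
    ∃ r > 0, ∃ K : NNReal, Metric.ball x₀ r ⊆ U ∧ LipschitzOnWith K g (Metric.ball x₀ r) ∧
      ∀ s, ∀ x ∈ Metric.ball x₀ r, ∀ y ∈ Metric.ball x₀ r, ‖x - x₀‖ ≤ s → ‖y - x₀‖ ≤ s →
        ‖g y - g x - fderiv ℝ g x₀ (y - x)‖ ≤ K * s * ‖y - x‖ := by
  have hUx : U ∈ 𝓝 x₀ := hU.mem_nhds hx₀
  have hd : ContDiffOn ℝ 1 (fderiv ℝ g) U := hg.fderiv_of_isOpen hU (by norm_num)
  obtain ⟨K₁, t₁, ht₁, hK₁⟩ :=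
    ((hg.contDiffAt hUx).of_le (by norm_num : (1 : WithTop ℕ∞) ≤ 2)).exists_lipschitzOnWith
  obtain ⟨K₂, t₂, ht₂, hK₂⟩ := (hd.contDiffAt hUx).exists_lipschitzOnWith
  obtain ⟨r, hr, hsub⟩ := Metric.mem_nhds_iff.1 (inter_mem hUx (inter_mem ht₁ ht₂))
  refine ⟨r, hr, max K₁ K₂, fun x hx => (hsub hx).1,
    (hK₁.mono fun x hx => (hsub hx).2.1).weaken (le_max_left _ _), ?_⟩
  intro s x hx y hy hxs hys
  have hs : 0 ≤ s := (norm_nonneg _).trans hxs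
  -- Mean value inequality on the convex set where the derivative is within `K s` of its value at
  -- `x₀`.
  refine Convex.norm_image_sub_le_of_norm_hasFDerivWithin_le' (𝕜 := ℝ)
    (s := Metric.ball x₀ r ∩ Metric.closedBall x₀ s) (f' := fderiv ℝ g) ?_ ?_
    ((convex_ball x₀ r).inter (convex_closedBall x₀ s)) ⟨hx, by simpa [dist_eq_norm] using hxs⟩
    ⟨hy, by simpa [dist_eq_norm] using hys⟩
  · intro z hz
    exact (((hg.differentiableOn (by norm_num)).differentiableAt
      (hU.mem_nhds (hsub hz.1).1)).hasFDerivAt).hasFDerivWithinAt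
  · intro z hz
    have h1 := hK₂.dist_le_mul z (hsub hz.1).2.2 x₀ (mem_of_mem_nhds ht₂)
    rw [dist_eq_norm] at h1
    refine h1.trans ?_
    have h2 : (K₂ : ℝ) ≤ (max K₁ K₂ : NNReal) := by exact_mod_cast le_max_right _ _
    gcongr
    exact hz.2

/-- Solutions of an autonomous differential equation with smooth right-hand side are smooth. -/
theorem contDiffOn_of_hasDerivWithinAt_comp {E : Type*} [NormedAddCommGroup E] [NormedSpace ℝ E]
    {f : E → E} {U : Set E} (hf : ContDiffOn ℝ ∞ f U) {y : ℝ → E} {I : Set ℝ}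
    (hI : UniqueDiffOn ℝ I) (hyU : MapsTo y I U)
    (hy : ∀ t ∈ I, HasDerivWithinAt y (f (y t)) I t) (n : ℕ) : ContDiffOn ℝ n y I := by
  induction n with
  | zero => exact contDiffOn_zero.2 fun t ht => (hy t ht).continuousWithinAt
  | succ n ih =>
    -- Bootstrapping: `y' = f ∘ y` is as regular as `y`, so `y` gains one derivative.
    have h : ContDiffOn ℝ ((n : WithTop ℕ∞) + 1) y I := by
      refine (contDiffOn_succ_iff_derivWithin hI).2
        ⟨fun t ht => (hy t ht).differentiableWithinAt, fun h => by simp at h, ?_⟩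
      refine ContDiffOn.congr (f := f ∘ y) ?_ fun t ht => (hy t ht).derivWithin (hI t ht)
      exact (hf.of_le (by exact_mod_cast le_top)).comp ih hyU
    exact_mod_cast h

/-- Third order Taylor expansion of a curve at the left end of an interval. -/
theorem ContDiffOn.exists_taylor_three {E : Type*} [NormedAddCommGroup E] [NormedSpace ℝ E]
    {y : ℝ → E} {t₀ T : ℝ} (hT : 0 ≤ T) (hy : ContDiffOn ℝ 4 y (Icc t₀ (t₀ + T))) :
    ∃ b c d : E, ∃ C ≥ 0, ∀ s ∈ Icc 0 T,
      ‖y (t₀ + s) - (y t₀ + s • b + s ^ 2 • c + s ^ 3 • d)‖ ≤ C * s ^ 4 := by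
  obtain ⟨C, hC⟩ := exists_taylor_mean_remainder_bound (n := 3) (by linarith : t₀ ≤ t₀ + T)
    (by norm_num; exact hy)
  refine ⟨iteratedDerivWithin 1 y (Icc t₀ (t₀ + T)) t₀,
    (1 / 2 : ℝ) • iteratedDerivWithin 2 y (Icc t₀ (t₀ + T)) t₀,
    (1 / 6 : ℝ) • iteratedDerivWithin 3 y (Icc t₀ (t₀ + T)) t₀, max C 0, le_max_right _ _, ?_⟩
  intro s hs
  have h := hC (t₀ + s) ⟨by linarith [hs.1], by linarith [hs.2]⟩
  simp only [taylorWithinEval_succ, taylor_within_zero_eval, add_sub_cancel_left] at h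
  norm_num [Nat.factorial] at h
  have h4 : C * s ^ 4 ≤ max C 0 * s ^ 4 :=
    mul_le_mul_of_nonneg_right (le_max_left _ _) (by positivity)
  refine le_trans (le_of_eq ?_) (h.trans h4)
  congr 1
  simp only [iteratedDerivWithin_one, smul_smul]
  module

/-- A `C¹` curve moves at most linearly fast away from its left end. -/
theorem ContDiffOn.exists_norm_sub_le_mul {E : Type*} [NormedAddCommGroup E] [NormedSpace ℝ E]
    {y : ℝ → E} {t₀ T : ℝ} (hT : 0 ≤ T) (hy : ContDiffOn ℝ 1 y (Icc t₀ (t₀ + T))) :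
    ∃ C ≥ 0, ∀ s ∈ Icc 0 T, ‖y (t₀ + s) - y t₀‖ ≤ C * s := by
  obtain ⟨C, hC⟩ := exists_taylor_mean_remainder_bound (n := 0) (by linarith : t₀ ≤ t₀ + T)
    (by norm_num; exact hy)
  refine ⟨max C 0, le_max_right _ _, fun s hs => ?_⟩
  have h := hC (t₀ + s) ⟨by linarith [hs.1], by linarith [hs.2]⟩
  simp only [taylor_within_zero_eval, add_sub_cancel_left, zero_add, pow_one] at h
  exact h.trans (mul_le_mul_of_nonneg_right (le_max_left _ _) hs.1)

/-! ### Fixed points on a ball -/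

/-- A contraction from an open ball to the concentric closed ball of half the radius has exactly
one fixed point. -/
theorem existsUnique_fixedPoint_ball {E : Type*} [NormedAddCommGroup E] [CompleteSpace E]
    {Φ : E → E} {x₀ : E} {ρ : ℝ} (hρ : 0 < ρ) {K : NNReal} (hK : K < 1)
    (hmaps : MapsTo Φ (Metric.ball x₀ ρ) (Metric.closedBall x₀ (ρ / 2)))
    (hlip : LipschitzOnWith K Φ (Metric.ball x₀ ρ)) :
    ∃! z, z ∈ Metric.ball x₀ ρ ∧ z = Φ z := by
  have hsub : Metric.closedBall x₀ (ρ / 2) ⊆ Metric.ball x₀ ρ :=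
    Metric.closedBall_subset_ball (by linarith)
  -- Existence needs the complete closed ball; uniqueness below uses the contraction on the whole
  -- open ball.
  obtain ⟨z, hz, hfix, -⟩ := ContractingWith.exists_fixedPoint'
    (Metric.isClosed_closedBall (x := x₀) (ε := ρ / 2)).isComplete (hmaps.mono_left hsub)
    ⟨hK, (hlip.mono hsub).mapsToRestrict (hmaps.mono_left hsub)⟩
    (Metric.mem_closedBall_self (by positivity)) (edist_ne_top _ _)
  refine ⟨z, ⟨hsub hz, hfix.symm⟩, fun w hw => ?_⟩
  have h := hlip.dist_le_mul w hw.1 z (hsub hz)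
  rw [← hw.2, hfix] at h
  have hK' : (K : ℝ) < 1 := by exact_mod_cast hK
  have := dist_nonneg (x := w) (y := z)
  exact dist_le_zero.1 (by nlinarith)

/-! ### The interpolating quadratic and its error -/

theorem continuous_quadCurve {m : ℕ} (y₀ y₁ z : PhaseSpace m) :
    Continuous (quadCurve y₀ y₁ z) := by
  unfold quadCurve
  fun_prop

/-- In Lagrange form the weights of `z - y₀` and `y₁ - y₀` are `τ(2τ - 1)` and `4τ(1 - τ)`, both of
modulus at most `1` on `[0, 1]`. -/
theorem norm_quadCurve_sub_le {m : ℕ} (y₀ y₁ z : PhaseSpace m) {τ : ℝ} (hτ : τ ∈ Icc (0 : ℝ) 1) :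
    ‖quadCurve y₀ y₁ z τ - y₀‖ ≤ ‖z - y₀‖ + ‖y₁ - y₀‖ := by
  obtain ⟨h0, h1⟩ := hτ
  have h : quadCurve y₀ y₁ z τ - y₀
      = (τ * (2 * τ - 1)) • (z - y₀) + (4 * τ * (1 - τ)) • (y₁ - y₀) := by
    unfold quadCurve
    module
  rw [h]
  refine (norm_add_le _ _).trans (add_le_add ?_ ?_) <;> rw [norm_smul, Real.norm_eq_abs] <;>
    refine mul_le_of_le_one_left (norm_nonneg _) (abs_le.2 ⟨?_, ?_⟩) <;>
    nlinarith [sq_nonneg (2 * τ - 1), mul_nonneg h0 (sub_nonneg.2 h1)]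

theorem norm_quadCurve_sub_quadCurve_le {m : ℕ} (y₀ y₁ z w : PhaseSpace m) {τ : ℝ}
    (hτ : τ ∈ Icc (0 : ℝ) 1) : ‖quadCurve y₀ y₁ z τ - quadCurve y₀ y₁ w τ‖ ≤ ‖z - w‖ := by
  obtain ⟨h0, h1⟩ := hτ
  have h : quadCurve y₀ y₁ z τ - quadCurve y₀ y₁ w τ = (τ * (2 * τ - 1)) • (z - w) := by
    unfold quadCurve
    module
  rw [h, norm_smul, Real.norm_eq_abs]
  refine mul_le_of_le_one_left (norm_nonneg _) (abs_le.2 ⟨?_, ?_⟩) <;>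
    nlinarith [sq_nonneg (2 * τ - 1), mul_nonneg h0 (sub_nonneg.2 h1)]

/-- Leading term of the interpolation error of the quadratic curve through `y(t₀)`, `y₁` and
`y(t₀ + 2h)`. -/
theorem norm_quadCurve_sub_add_le {m : ℕ} {y : ℝ → PhaseSpace m} {t₀ T : ℝ}
    {b c d : PhaseSpace m} {C : ℝ} (hC : 0 ≤ C)
    (hy : ∀ s ∈ Icc 0 T, ‖y (t₀ + s) - (y t₀ + s • b + s ^ 2 • c + s ^ 3 • d)‖ ≤ C * s ^ 4)
    {h : ℝ} (h0 : 0 ≤ h) (hT : 2 * h ≤ T) {y₁ : PhaseSpace m} {D : ℝ}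
    (hy₁ : ‖y (t₀ + h) - y₁‖ ≤ D * h ^ 4) {τ : ℝ} (hτ : τ ∈ Icc (0 : ℝ) 1) :
    ‖quadCurve (y t₀) y₁ (y (t₀ + 2 * h)) τ - y (t₀ + 2 * h * τ)
        + (8 * h ^ 3 * (τ * (τ - 1 / 2) * (τ - 1))) • d‖ ≤ (50 * C + 2 * D) * h ^ 4 := by
  obtain ⟨hτ0, hτ1⟩ := hτ
  set R : ℝ → PhaseSpace m :=
    fun s => y (t₀ + s) - (y t₀ + s • b + s ^ 2 • c + s ^ 3 • d) with hR
  have hle : 2 * h * τ ≤ 2 * h := mul_le_of_le_one_right (by positivity) hτ1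
  have hR1 : ‖R h‖ ≤ C * h ^ 4 := hy h ⟨h0, by linarith⟩
  have hR2 : ‖R (2 * h)‖ ≤ 16 * C * h ^ 4 :=
    (hy (2 * h) ⟨by positivity, hT⟩).trans_eq (by ring)
  have hR3 : ‖R (2 * h * τ)‖ ≤ 16 * C * h ^ 4 := by
    refine (hy (2 * h * τ) ⟨by positivity, hle.trans hT⟩).trans ?_
    have : (2 * h * τ) ^ 4 ≤ (2 * h) ^ 4 := by gcongr
    nlinarith [mul_le_mul_of_nonneg_left this hC]
  -- Interpolation reproduces quadratics, so `b` and `c` cancel; the cubic leaves exactly the nodal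
  -- polynomial times `d`. The rest adds up to at most `(33 C + D) h⁴`, within the stated bound.
  have key : quadCurve (y t₀) y₁ (y (t₀ + 2 * h)) τ - y (t₀ + 2 * h * τ)
        + (8 * h ^ 3 * (τ * (τ - 1 / 2) * (τ - 1))) • d
      = (τ * (2 * τ - 1)) • R (2 * h) + (4 * τ * (1 - τ)) • R h
        + (4 * τ * (τ - 1)) • (y (t₀ + h) - y₁) - R (2 * h * τ) := by
    simp only [hR, quadCurve]
    module
  have h1 : |τ * (2 * τ - 1)| ≤ 1 := abs_le.2
    ⟨by nlinarith [sq_nonneg (2 * τ - 1)], by nlinarith [mul_nonneg hτ0 (sub_nonneg.2 hτ1)]⟩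
  have h2 : |4 * τ * (1 - τ)| ≤ 1 := abs_le.2
    ⟨by nlinarith [mul_nonneg hτ0 (sub_nonneg.2 hτ1)], by nlinarith [sq_nonneg (2 * τ - 1)]⟩
  have h3 : |4 * τ * (τ - 1)| ≤ 1 := by
    rwa [← abs_neg, show -(4 * τ * (τ - 1)) = 4 * τ * (1 - τ) by ring]
  have hsm : ∀ (a : ℝ) (v : PhaseSpace m), |a| ≤ 1 → ‖a • v‖ ≤ ‖v‖ := fun a v ha => by
    rw [norm_smul, Real.norm_eq_abs]
    exact mul_le_of_le_one_left (norm_nonneg _) ha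
  rw [key]
  have n1 := norm_sub_le ((τ * (2 * τ - 1)) • R (2 * h) + (4 * τ * (1 - τ)) • R h
        + (4 * τ * (τ - 1)) • (y (t₀ + h) - y₁)) (R (2 * h * τ))
  have n2 := norm_add₃_le (a := (τ * (2 * τ - 1)) • R (2 * h)) (b := (4 * τ * (1 - τ)) • R h)
    (c := (4 * τ * (τ - 1)) • (y (t₀ + h) - y₁))
  have := hsm _ (R (2 * h)) h1
  have := hsm _ (R h) h2
  have := hsm _ (y (t₀ + h) - y₁) h3
  have : 0 ≤ C * h ^ 4 := by positivity
  have : 0 ≤ D * h ^ 4 := (norm_nonneg _).trans hy₁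
  nlinarith

/-! ### Averages along curves -/

theorem integral_symmetric_cubic : ∫ τ in (0 : ℝ)..1, τ * (τ - 1 / 2) * (τ - 1) = 0 := by
  have h : ∀ τ : ℝ, τ * (τ - 1 / 2) * (τ - 1) = τ ^ 3 - 3 / 2 * τ ^ 2 + 1 / 2 * τ ^ 1 :=
    fun τ => by ring
  simp_rw [h]
  rw [intervalIntegral.integral_add, intervalIntegral.integral_sub]
  · simp only [intervalIntegral.integral_const_mul, integral_pow]
    norm_num
  all_goals exact Continuous.intervalIntegrable (by fun_prop) _ _

/-- If two curves differ by a small multiple of `τ (τ - 1/2) (τ - 1)`, up to higher order, then the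
integrals of a nearly linear map along them agree to higher order. -/
theorem norm_integral_comp_sub_le {E F : Type*} [NormedAddCommGroup E] [NormedSpace ℝ E]
    [NormedAddCommGroup F] [NormedSpace ℝ F] [CompleteSpace F] {g : E → F} {G : E →L[ℝ] F}
    {u v : ℝ → E} {d : E} {κ ε δ : ℝ}
    (hu : ContinuousOn (fun τ => g (u τ)) (Icc 0 1))
    (hv : ContinuousOn (fun τ => g (v τ)) (Icc 0 1))
    (hlin : ∀ τ ∈ Icc (0 : ℝ) 1, ‖g (u τ) - g (v τ) - G (u τ - v τ)‖ ≤ ε)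
    (huv : ∀ τ ∈ Icc (0 : ℝ) 1, ‖u τ - v τ + (κ * (τ * (τ - 1 / 2) * (τ - 1))) • d‖ ≤ δ) :
    ‖(∫ τ in (0 : ℝ)..1, g (u τ)) - ∫ τ in (0 : ℝ)..1, g (v τ)‖ ≤ ε + ‖G‖ * δ := by
  have iu := hu.intervalIntegrable_of_Icc (μ := MeasureTheory.volume) zero_le_one
  have iv := hv.intervalIntegrable_of_Icc (μ := MeasureTheory.volume) zero_le_one
  have iw : IntervalIntegrable (fun τ : ℝ => (κ * (τ * (τ - 1 / 2) * (τ - 1))) • G d)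
      MeasureTheory.volume 0 1 := Continuous.intervalIntegrable (by fun_prop) _ _
  have hw : ∫ τ in (0 : ℝ)..1, (κ * (τ * (τ - 1 / 2) * (τ - 1))) • G d = 0 := by
    rw [intervalIntegral.integral_smul_const, intervalIntegral.integral_const_mul,
      integral_symmetric_cubic, mul_zero, zero_smul]
  -- Adding an integral equal to zero cancels the leading part of `G (u - v)` pointwise.
  rw [← intervalIntegral.integral_sub iu iv, ← add_zero (∫ τ in (0 : ℝ)..1, _), ← hw,
    ← intervalIntegral.integral_add (iu.sub iv) iw]
  refine (intervalIntegral.norm_integral_le_of_norm_le_const (C := ε + ‖G‖ * δ) ?_).trans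
    (by simp)
  intro τ hτ
  rw [uIoc_of_le zero_le_one] at hτ
  have hτ' := Ioc_subset_Icc_self hτ
  have e : g (u τ) - g (v τ) + (κ * (τ * (τ - 1 / 2) * (τ - 1))) • G d
      = (g (u τ) - g (v τ) - G (u τ - v τ))
        + G (u τ - v τ + (κ * (τ * (τ - 1 / 2) * (τ - 1))) • d) := by
    rw [map_add, map_smul]
    abel
  rw [e]
  exact (norm_add_le _ _).trans (add_le_add (hlin τ hτ')
    ((G.le_opNorm _).trans (mul_le_mul_of_nonneg_left (huv τ hτ') (norm_nonneg _))))

/-- The Hamiltonian flow in integrated form, with the time rescaled to `[0, 1]`. -/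
theorem IsHamiltonianSolution.eq_add_integral {m : ℕ} {U : Set (PhaseSpace m)}
    {H : PhaseSpace m → ℝ} {t₀ T : ℝ} {y₀ : PhaseSpace m} {y : ℝ → PhaseSpace m}
    (hy : IsHamiltonianSolution U H t₀ T y₀ y) (hH : ContinuousOn (∇ H) U) {h : ℝ} (h0 : 0 < h)
    (hT : 2 * h ≤ T) :
    y (t₀ + 2 * h) = y₀ + (2 * h) • symplecticMap m
      (∫ τ in (0 : ℝ)..1, ∇ H (y (t₀ + 2 * h * τ))) := by
  have hmaps : MapsTo (fun τ : ℝ => t₀ + 2 * h * τ) (Icc 0 1) (Icc t₀ (t₀ + T)) := by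
    intro τ hτ
    have : 0 ≤ 2 * h * τ := mul_nonneg (by positivity) hτ.1
    have : 2 * h * τ ≤ 2 * h := mul_le_of_le_one_right (by positivity) hτ.2
    exact ⟨by linarith, by linarith⟩
  have hyc : ContinuousOn (fun τ : ℝ => y (t₀ + 2 * h * τ)) (Icc 0 1) :=
    ContinuousOn.comp (g := y) (fun t ht => (hy.2 t ht).2.continuousWithinAt) (by fun_prop) hmaps
  have hgc : ContinuousOn (fun τ : ℝ => ∇ H (y (t₀ + 2 * h * τ))) (Icc 0 1) :=
    hH.comp hyc fun τ hτ => (hy.2 _ (hmaps hτ)).1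
  have hint := hgc.intervalIntegrable_of_Icc (μ := MeasureTheory.volume) zero_le_one
  -- Interior times suffice for the fundamental theorem, and there the one-sided derivative is
  -- two-sided.
  have hderiv : ∀ τ ∈ Ioo (0 : ℝ) 1, HasDerivAt (fun τ : ℝ => y (t₀ + 2 * h * τ))
      ((2 * h) • symplecticMap m (∇ H (y (t₀ + 2 * h * τ)))) τ := by
    intro τ hτ
    have : 0 < 2 * h * τ := mul_pos (by positivity) hτ.1
    have : 2 * h * τ < 2 * h := mul_lt_of_lt_one_right (by positivity) hτ.2
    have hd := ((hy.2 _ (hmaps (Ioo_subset_Icc_self hτ))).2).hasDerivAt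
      (Icc_mem_nhds (by linarith) (by linarith))
    have hl : HasDerivAt (fun τ : ℝ => t₀ + 2 * h * τ) (2 * h) τ := by
      simpa using ((hasDerivAt_id τ).const_mul (2 * h)).const_add t₀
    exact HasDerivAt.scomp τ hd hl
  have hcont : ContinuousOn
      (fun τ : ℝ => (2 * h) • symplecticMap m (∇ H (y (t₀ + 2 * h * τ)))) (Icc 0 1) :=
    ContinuousOn.const_smul ((symplecticMap m).continuous.comp_continuousOn hgc) (2 * h)
  have key := intervalIntegral.integral_eq_sub_of_hasDerivAt_of_le zero_le_one hyc hderiv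
    (hcont.intervalIntegrable_of_Icc zero_le_one)
  rw [intervalIntegral.integral_smul,
    ContinuousLinearMap.intervalIntegral_comp_comm _ hint] at key
  simp only [mul_one, mul_zero, add_zero, hy.1] at key
  rw [key]
  abel

/-! ### Contraction estimates -/

section AveragedGradient

variable {m : ℕ} {H : PhaseSpace m → ℝ} {y₀ y₁ : PhaseSpace m} {r : ℝ} {K : NNReal}

theorem quadCurve_mem_ball (hy₁ : ‖y₁ - y₀‖ < r / 2) {z : PhaseSpace m}
    (hz : z ∈ Metric.ball y₀ (r / 2)) {τ : ℝ} (hτ : τ ∈ Icc (0 : ℝ) 1) :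
    quadCurve y₀ y₁ z τ ∈ Metric.ball y₀ r := by
  rw [mem_ball_iff_norm] at hz ⊢
  linarith [norm_quadCurve_sub_le y₀ y₁ z hτ]

theorem continuousOn_gradient_quadCurve (hK : LipschitzOnWith K (∇ H) (Metric.ball y₀ r))
    (hy₁ : ‖y₁ - y₀‖ < r / 2) {z : PhaseSpace m} (hz : z ∈ Metric.ball y₀ (r / 2)) :
    ContinuousOn (fun τ => ∇ H (quadCurve y₀ y₁ z τ)) (Icc 0 1) :=
  hK.continuousOn.comp (continuous_quadCurve y₀ y₁ z).continuousOn
    fun _ hτ => quadCurve_mem_ball hy₁ hz hτ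

theorem norm_averagedGradient_sub_le (hK : LipschitzOnWith K (∇ H) (Metric.ball y₀ r))
    (hy₁ : ‖y₁ - y₀‖ < r / 2) {z w : PhaseSpace m} (hz : z ∈ Metric.ball y₀ (r / 2))
    (hw : w ∈ Metric.ball y₀ (r / 2)) :
    ‖averagedGradient H y₀ y₁ z - averagedGradient H y₀ y₁ w‖ ≤ K * ‖z - w‖ := by
  unfold averagedGradient
  rw [← intervalIntegral.integral_sub
    ((continuousOn_gradient_quadCurve hK hy₁ hz).intervalIntegrable_of_Icc zero_le_one)
    ((continuousOn_gradient_quadCurve hK hy₁ hw).intervalIntegrable_of_Icc zero_le_one)]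
  refine (intervalIntegral.norm_integral_le_of_norm_le_const (C := K * ‖z - w‖) ?_).trans
    (by simp)
  intro τ hτ
  rw [uIoc_of_le zero_le_one] at hτ
  have hτ' := Ioc_subset_Icc_self hτ
  refine (hK.norm_sub_le (quadCurve_mem_ball hy₁ hz hτ')
    (quadCurve_mem_ball hy₁ hw hτ')).trans ?_
  gcongr
  exact norm_quadCurve_sub_quadCurve_le y₀ y₁ z w hτ'

theorem norm_averagedGradient_le (hK : LipschitzOnWith K (∇ H) (Metric.ball y₀ r))
    (hr : 0 < r) (hy₁ : ‖y₁ - y₀‖ < r / 2) {z : PhaseSpace m}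
    (hz : z ∈ Metric.ball y₀ (r / 2)) :
    ‖averagedGradient H y₀ y₁ z‖ ≤ ‖∇ H y₀‖ + K * r := by
  refine (intervalIntegral.norm_integral_le_of_norm_le_const (C := ‖∇ H y₀‖ + K * r) ?_).trans
    (by simp)
  intro τ hτ
  rw [uIoc_of_le zero_le_one] at hτ
  have hq := quadCurve_mem_ball hy₁ hz (Ioc_subset_Icc_self hτ)
  have h1 := hK.norm_sub_le hq (Metric.mem_ball_self hr)
  have h2 : (K : ℝ) * ‖quadCurve y₀ y₁ z τ - y₀‖ ≤ K * r := by
    gcongr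
    exact (mem_ball_iff_norm.1 hq).le
  have h3 := norm_sub_norm_le (∇ H (quadCurve y₀ y₁ z τ)) (∇ H y₀)
  linarith

theorem norm_uncorrectedMap_sub_le (hK : LipschitzOnWith K (∇ H) (Metric.ball y₀ r))
    (hy₁ : ‖y₁ - y₀‖ < r / 2) {h : ℝ} (h0 : 0 ≤ h)
    (hh : 2 * h * ‖symplecticMap m‖ * K ≤ 1 / 2) {z w : PhaseSpace m}
    (hz : z ∈ Metric.ball y₀ (r / 2)) (hw : w ∈ Metric.ball y₀ (r / 2)) :
    ‖uncorrectedMap H h y₀ y₁ z - uncorrectedMap H h y₀ y₁ w‖ ≤ 1 / 2 * ‖z - w‖ := by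
  unfold uncorrectedMap
  rw [add_sub_add_left_eq_sub, ← smul_sub, ← map_sub, norm_smul, Real.norm_of_nonneg (by positivity)]
  calc _ ≤ 2 * h * (‖symplecticMap m‖ * (K * ‖z - w‖)) := by
        gcongr
        exact (ContinuousLinearMap.le_opNorm _ _).trans
          (by gcongr; exact norm_averagedGradient_sub_le hK hy₁ hz hw)
    _ = 2 * h * ‖symplecticMap m‖ * K * ‖z - w‖ := by ring
    _ ≤ _ := by gcongr

/-- `hh` gives the contraction constant `1/2`; `hM` keeps the image in the closed ball of radius `r
/ 4`, half of `r / 2`. -/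
theorem existsUnique_eq_uncorrectedMap (hK : LipschitzOnWith K (∇ H) (Metric.ball y₀ r))
    (hr : 0 < r) (hy₁ : ‖y₁ - y₀‖ < r / 2) {h : ℝ} (h0 : 0 ≤ h)
    (hh : 2 * h * ‖symplecticMap m‖ * K ≤ 1 / 2)
    (hM : 2 * h * ‖symplecticMap m‖ * (‖∇ H y₀‖ + K * r) ≤ r / 4) :
    ∃! z, z ∈ Metric.ball y₀ (r / 2) ∧ z = uncorrectedMap H h y₀ y₁ z := by
  refine existsUnique_fixedPoint_ball (half_pos hr) (K := 1 / 2) (by norm_num) ?_ ?_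
  · intro z hz
    rw [mem_closedBall_iff_norm, uncorrectedMap, add_sub_cancel_left, norm_smul,
      Real.norm_of_nonneg (by positivity)]
    calc _ ≤ 2 * h * (‖symplecticMap m‖ * (‖∇ H y₀‖ + K * r)) := by
          gcongr
          exact (ContinuousLinearMap.le_opNorm _ _).trans
            (by gcongr; exact norm_averagedGradient_le hK hr hy₁ hz)
      _ ≤ _ := by linarith
  · refine LipschitzOnWith.of_dist_le_mul fun z hz w hw => ?_
    rw [dist_eq_norm, dist_eq_norm]
    simpa using norm_uncorrectedMap_sub_le hK hy₁ h0 hh hz hw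

end AveragedGradient

/-! ### Local defect -/

/-- Local defect: the exact solution satisfies the nonlinear system up to `O(h⁵)`. -/
theorem IsHamiltonianSolution.isBigO_sub_uncorrectedMap {m : ℕ} {U : Set (PhaseSpace m)}
    (hU : IsOpen U) {H : PhaseSpace m → ℝ} (hH : ContDiffOn ℝ ∞ (∇ H) U) {t₀ T : ℝ} (hT : 0 < T)
    {y₀ : PhaseSpace m} {y : ℝ → PhaseSpace m} (hy : IsHamiltonianSolution U H t₀ T y₀ y)
    {y₁ : ℝ → PhaseSpace m}
    (hy₁ : (fun h : ℝ => y (t₀ + h) - y₁ h) =O[𝓝[>] 0] (fun h : ℝ => h ^ 4)) :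
    (fun h => y (t₀ + 2 * h) - uncorrectedMap H h y₀ (y₁ h) (y (t₀ + 2 * h)))
      =O[𝓝[>] 0] (fun h : ℝ => h ^ 5) := by
  have hmem : ∀ t ∈ Icc t₀ (t₀ + T), y t ∈ U := fun t ht => (hy.2 t ht).1
  have hyt : y t₀ = y₀ := hy.1
  have hy₀ : y₀ ∈ U := hyt ▸ hmem t₀ ⟨le_rfl, by linarith⟩
  have hyn : ∀ n : ℕ, ContDiffOn ℝ n y (Icc t₀ (t₀ + T)) :=
    contDiffOn_of_hasDerivWithinAt_comp ((symplecticMap m).contDiff.comp_contDiffOn hH)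
      (uniqueDiffOn_Icc (by linarith)) hmem fun t ht => (hy.2 t ht).2
  obtain ⟨b, c, d, C₃, hC₃, htay⟩ := (by exact_mod_cast hyn 4 :
    ContDiffOn ℝ 4 y (Icc t₀ (t₀ + T))).exists_taylor_three hT.le
  obtain ⟨C, hC, hlin⟩ := (by exact_mod_cast hyn 1 :
    ContDiffOn ℝ 1 y (Icc t₀ (t₀ + T))).exists_norm_sub_le_mul hT.le
  obtain ⟨r, hr, K, hrU, hK, hquad⟩ :=
    (by exact_mod_cast contDiffOn_infty.1 hH 2 :
      ContDiffOn ℝ 2 (∇ H) U).exists_ball_lipschitzOnWith_and_linearization hU hy₀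
  obtain ⟨D, hD, hDb⟩ := hy₁.exists_pos
  set G := fderiv ℝ (∇ H) y₀
  set Q := 50 * C₃ + 2 * D + 8 * ‖d‖
  refine IsBigO.of_bound (2 * ‖symplecticMap m‖ *
    (K * (3 * C + D) * Q + ‖G‖ * (50 * C₃ + 2 * D))) ?_
  have hsmall : ∀ δ > (0 : ℝ), ∀ᶠ h in 𝓝[>] (0 : ℝ), h < δ := fun δ hδ =>
    mem_nhdsWithin_of_mem_nhds (Iio_mem_nhds hδ)
  -- Ensures `(3C + D) h < r`, so both curves stay in the ball: `2C` and `C` come from the exact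
  -- values at `2h` and `h`, `D` from the error of `y₁`.
  have hr' : 0 < r / (3 * C + D + 1) := by positivity
  filter_upwards [hDb.bound, self_mem_nhdsWithin, hsmall 1 one_pos, hsmall (T / 2) (half_pos hT),
    hsmall _ hr'] with h hDh h0 h1 hTh hrh
  simp only [mem_Ioi] at h0
  rw [lt_div_iff₀ (by positivity)] at hrh
  rw [Real.norm_of_nonneg (by positivity)] at hDh ⊢
  have h41 : h ^ 4 ≤ h := pow_le_of_le_one h0.le h1.le (by norm_num)
  have h43 : h ^ 4 ≤ h ^ 3 := pow_le_pow_of_le_one h0.le h1.le (by norm_num)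
  have hs : ∀ τ ∈ Icc (0 : ℝ) 1, 2 * h * τ ∈ Icc 0 T := fun τ hτ => by
    have := mul_le_of_le_one_right (by positivity : 0 ≤ 2 * h) hτ.2
    exact ⟨mul_nonneg (by positivity) hτ.1, by linarith⟩
  have hv : ∀ τ ∈ Icc (0 : ℝ) 1, ‖y (t₀ + 2 * h * τ) - y₀‖ ≤ 2 * C * h := fun τ hτ => by
    have := hlin _ (hs τ hτ)
    rw [hyt] at this
    have h2 := mul_le_of_le_one_right (by positivity : 0 ≤ C * (2 * h)) hτ.2
    linarith
  have hDh' : D * h ^ 4 ≤ D * h := by gcongr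
  have hu : ∀ τ ∈ Icc (0 : ℝ) 1,
      ‖quadCurve y₀ (y₁ h) (y (t₀ + 2 * h)) τ - y₀‖ ≤ (3 * C + D) * h := fun τ hτ => by
    have a1 := norm_quadCurve_sub_le y₀ (y₁ h) (y (t₀ + 2 * h)) hτ
    have a2 := hv 1 (by simp)
    rw [mul_one] at a2
    have a3 := hlin h ⟨h0.le, by linarith⟩
    rw [hyt] at a3
    have a4 := norm_sub_le (y (t₀ + h) - y₀) (y (t₀ + h) - y₁ h)
    rw [sub_sub_sub_cancel_left] at a4
    linarith
  have hCh : 0 ≤ C * h := by positivity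
  have hDh0 : 0 ≤ D * h := by positivity
  have hub : ∀ τ ∈ Icc (0 : ℝ) 1,
      quadCurve y₀ (y₁ h) (y (t₀ + 2 * h)) τ ∈ Metric.ball y₀ r := fun τ hτ => by
    rw [mem_ball_iff_norm]
    linarith [hu τ hτ]
  have hvb : ∀ τ ∈ Icc (0 : ℝ) 1, y (t₀ + 2 * h * τ) ∈ Metric.ball y₀ r := fun τ hτ => by
    rw [mem_ball_iff_norm]
    linarith [hv τ hτ]
  have herr : ∀ τ ∈ Icc (0 : ℝ) 1, _ := fun τ hτ =>
    norm_quadCurve_sub_add_le hC₃ htay h0.le (by linarith) hDh hτ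
  simp only [hyt] at herr
  have hdiff : ∀ τ ∈ Icc (0 : ℝ) 1,
      ‖quadCurve y₀ (y₁ h) (y (t₀ + 2 * h)) τ - y (t₀ + 2 * h * τ)‖ ≤ Q * h ^ 3 := by
    intro τ hτ
    have e1 := herr τ hτ
    have e2 : ‖(8 * h ^ 3 * (τ * (τ - 1 / 2) * (τ - 1))) • d‖ ≤ 8 * h ^ 3 * ‖d‖ := by
      rw [norm_smul, norm_mul, Real.norm_of_nonneg (by positivity : 0 ≤ 8 * h ^ 3)]
      refine mul_le_mul_of_nonneg_right (mul_le_of_le_one_right (by positivity) ?_) (norm_nonneg _)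
      obtain ⟨hτ0, hτ1⟩ := hτ
      rw [norm_mul, norm_mul, Real.norm_eq_abs, Real.norm_eq_abs, Real.norm_eq_abs]
      refine mul_le_one₀ (mul_le_one₀ ?_ (abs_nonneg _) ?_) (abs_nonneg _) ?_ <;>
        rw [abs_le] <;> constructor <;> linarith
    have e3 := norm_sub_le (quadCurve y₀ (y₁ h) (y (t₀ + 2 * h)) τ - y (t₀ + 2 * h * τ)
      + (8 * h ^ 3 * (τ * (τ - 1 / 2) * (τ - 1))) • d)
      ((8 * h ^ 3 * (τ * (τ - 1 / 2) * (τ - 1))) • d)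
    rw [add_sub_cancel_right] at e3
    have e4 : (50 * C₃ + 2 * D) * h ^ 4 ≤ (50 * C₃ + 2 * D) * h ^ 3 := by gcongr
    simp only [Q]
    linarith
  have hyc : ContinuousOn (fun τ : ℝ => y (t₀ + 2 * h * τ)) (Icc 0 1) :=
    (hyn 0).continuousOn.comp (by fun_prop) fun τ hτ =>
      ⟨by linarith [(hs τ hτ).1], by linarith [(hs τ hτ).2]⟩
  have hint := norm_integral_comp_sub_le (g := ∇ H) (G := G) (ε := K * (3 * C + D) * Q * h ^ 4)
    (hK.continuousOn.comp (continuous_quadCurve y₀ (y₁ h) (y (t₀ + 2 * h))).continuousOn hub)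
    (hK.continuousOn.comp hyc hvb)
    (fun τ hτ => by
      refine (hquad ((3 * C + D) * h) _ (hvb τ hτ) _ (hub τ hτ) (by linarith [hv τ hτ])
        (hu τ hτ)).trans ?_
      calc _ ≤ K * ((3 * C + D) * h) * (Q * h ^ 3) := by
            gcongr
            exact hdiff τ hτ
        _ = _ := by ring)
    herr
  have hsol := hy.eq_add_integral hH.continuousOn h0 (by linarith)
  have hdef : y (t₀ + 2 * h) - uncorrectedMap H h y₀ (y₁ h) (y (t₀ + 2 * h))
      = -((2 * h) • symplecticMap m (averagedGradient H y₀ (y₁ h) (y (t₀ + 2 * h))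
        - ∫ τ in (0 : ℝ)..1, ∇ H (y (t₀ + 2 * h * τ)))) := by
    rw [uncorrectedMap]
    nth_rw 1 [hsol]
    rw [map_sub, smul_sub]
    abel
  rw [hdef, norm_neg, norm_smul, Real.norm_of_nonneg (by positivity)]
  calc _ ≤ 2 * h * (‖symplecticMap m‖ *
        (K * (3 * C + D) * Q * h ^ 4 + ‖G‖ * ((50 * C₃ + 2 * D) * h ^ 4))) := by
        gcongr
        exact (ContinuousLinearMap.le_opNorm _ _).trans (by gcongr; exact hint)
    _ = _ := by ring

/-! ### Solvability and the error bound -/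

theorem lemma2 (m : ℕ)
    -- a smooth Hamiltonian on an open domain, and the exact solution of the initial value problem
    (U : Set (PhaseSpace m)) (hU : IsOpen U)
    (H : PhaseSpace m → ℝ) (hH : ContDiffOn ℝ ∞ H U)
    (t₀ T : ℝ) (hT : 0 < T) (y₀ : PhaseSpace m) (y : ℝ → PhaseSpace m)
    (hy : IsHamiltonianSolution U H t₀ T y₀ y)
    -- the given approximation of `y(t₀ + h)`, as a function of the stepsize
    (p : ℕ) (hp : 4 ≤ p) (y₁ : ℝ → PhaseSpace m)
    (hy₁ : (fun h : ℝ => y (t₀ + h) - y₁ h) =O[𝓝[>] 0] (fun h : ℝ => h ^ (p + 1))) :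
    ∃ ρ > 0, ∃ h₀ > 0, 2 * h₀ ≤ T ∧ ∃ zhat : ℝ → PhaseSpace m,
      (∀ h ∈ Ioc 0 h₀,
        -- all curves lie in the domain of `H`
        (∀ z ∈ Metric.ball y₀ ρ, ∀ τ ∈ Icc (0 : ℝ) 1, quadCurve y₀ (y₁ h) z τ ∈ U) ∧
        -- `zhat h` is the unique solution in the ball
        zhat h ∈ Metric.ball y₀ ρ ∧ zhat h = uncorrectedMap H h y₀ (y₁ h) (zhat h) ∧
        (∀ z ∈ Metric.ball y₀ ρ, z = uncorrectedMap H h y₀ (y₁ h) z → z = zhat h)) ∧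
      (fun h : ℝ => y (t₀ + 2 * h) - zhat h) =O[𝓝[>] 0] (fun h : ℝ => h ^ 5) := by
  have hG : ContDiffOn ℝ ∞ (∇ H) U := hH.gradient_of_isOpen hU (by simp)
  have hy₀ : y₀ ∈ U := hy.1 ▸ (hy.2 t₀ ⟨le_rfl, by linarith⟩).1
  obtain ⟨r, hr, K, hrU, hK, -⟩ := (by exact_mod_cast contDiffOn_infty.1 hG 2 :
      ContDiffOn ℝ 2 (∇ H) U).exists_ball_lipschitzOnWith_and_linearization hU hy₀
  -- Order `h⁴` suffices for `y₁`, since its error enters only through the average, which carries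
  -- the factor `2h`.
  have hy₁' : (fun h : ℝ => y (t₀ + h) - y₁ h) =O[𝓝[>] 0] (fun h : ℝ => h ^ 4) := by
    refine hy₁.trans (IsBigO.of_bound 1 ?_)
    filter_upwards [Ioc_mem_nhdsGT one_pos] with h hh
    rw [one_mul, norm_pow, norm_pow, Real.norm_of_nonneg hh.1.le]
    exact pow_le_pow_of_le_one hh.1.le hh.2 (by omega)
  have hyc : Tendsto (fun s => y (t₀ + s)) (𝓝[>] 0) (𝓝 y₀) := by
    have h1 := (hy.2 t₀ ⟨le_rfl, by linarith⟩).2.continuousWithinAt.tendsto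
    rw [hy.1] at h1
    refine h1.comp (tendsto_nhdsWithin_iff.2 ⟨?_, ?_⟩)
    · refine Tendsto.mono_left ?_ nhdsWithin_le_nhds
      simpa using (continuous_const_add t₀).tendsto 0
    · filter_upwards [Ioc_mem_nhdsGT hT] with s hs
      exact ⟨by linarith [hs.1], by linarith [hs.2]⟩
  have hyc₂ : Tendsto (fun s => y (t₀ + 2 * s)) (𝓝[>] 0) (𝓝 y₀) := by
    refine hyc.comp (tendsto_nhdsWithin_iff.2 ⟨?_, ?_⟩)
    · refine Tendsto.mono_left ?_ nhdsWithin_le_nhds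
      simpa using (continuous_const_mul (2 : ℝ)).tendsto 0
    · filter_upwards [self_mem_nhdsWithin] with s hs
      exact mul_pos two_pos (mem_Ioi.1 hs)
  have hy₁c : Tendsto y₁ (𝓝[>] 0) (𝓝 y₀) := by
    have h4 : Tendsto (fun h : ℝ => h ^ 4) (𝓝[>] 0) (𝓝 0) := by
      simpa using ((continuous_pow 4 (M := ℝ)).tendsto 0).mono_left nhdsWithin_le_nhds
    simpa using hyc.sub (hy₁'.trans_tendsto h4)
  have hlin : ∀ a b : ℝ, 0 < b → ∀ᶠ h in 𝓝[>] (0 : ℝ), 2 * h * ‖symplecticMap m‖ * a ≤ b := by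
    intro a b hb
    have h1 : Continuous fun h : ℝ => 2 * h * ‖symplecticMap m‖ * a := by fun_prop
    have h2 := (h1.tendsto 0).mono_left (nhdsWithin_le_nhds (s := Ioi 0))
    simp only [mul_zero, zero_mul] at h2
    exact h2.eventually_le_const hb
  have hev : ∀ᶠ h in 𝓝[>] (0 : ℝ), h ≤ T / 2 ∧ ‖y₁ h - y₀‖ < r / 2 ∧
      y (t₀ + 2 * h) ∈ Metric.ball y₀ (r / 2) ∧
      2 * h * ‖symplecticMap m‖ * K ≤ 1 / 2 ∧
      2 * h * ‖symplecticMap m‖ * (‖∇ H y₀‖ + K * r) ≤ r / 4 := by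
    filter_upwards [Ioc_mem_nhdsGT (half_pos hT),
      hy₁c.eventually_mem (Metric.ball_mem_nhds y₀ (half_pos hr)),
      hyc₂.eventually_mem (Metric.ball_mem_nhds y₀ (half_pos hr)),
      hlin K (1 / 2) (by norm_num), hlin (‖∇ H y₀‖ + K * r) (r / 4) (by positivity)]
      with h a1 a2 a3 a4 a5
    exact ⟨a1.2, mem_ball_iff_norm.1 a2, a3, a4, a5⟩
  obtain ⟨h₀, hh₀, hsub⟩ := mem_nhdsGT_iff_exists_Ioc_subset.1 hev
  have hex : ∀ h ∈ Ioc 0 h₀,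
      ∃! z, z ∈ Metric.ball y₀ (r / 2) ∧ z = uncorrectedMap H h y₀ (y₁ h) z := fun h hh =>
    let ⟨_, a2, _, a4, a5⟩ := hsub hh
    existsUnique_eq_uncorrectedMap hK hr a2 hh.1.le a4 a5
  choose! zhat hz huniq using hex
  refine ⟨r / 2, half_pos hr, h₀, hh₀, ?_, zhat, fun h hh => ⟨?_, (hz h hh).1, (hz h hh).2,
    fun z hzb hze => huniq h hh z ⟨hzb, hze⟩⟩, ?_⟩
  · have := (hsub ⟨hh₀, le_rfl⟩).1
    linarith
  · exact fun z hzb τ hτ => hrU (quadCurve_mem_ball (hsub hh).2.1 hzb hτ)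
  -- The error `e` satisfies `e ≤ defect + e / 2`, hence the constant `2`.
  · refine IsBigO.trans (IsBigO.of_bound 2 ?_) (hy.isBigO_sub_uncorrectedMap hU hG hT hy₁')
    filter_upwards [Ioc_mem_nhdsGT hh₀] with h hh
    obtain ⟨-, a2, a3, a4, -⟩ := hsub hh
    have e1 := norm_uncorrectedMap_sub_le hK a2 hh.1.le a4 a3 (hz h hh).1
    rw [← (hz h hh).2] at e1
    have e2 := norm_sub_le_norm_sub_add_norm_sub (y (t₀ + 2 * h))
      (uncorrectedMap H h y₀ (y₁ h) (y (t₀ + 2 * h))) (zhat h)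
    linarith
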